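/- Let $m\ge 1$, let $\mathbb F_{2^m}$ be the field with $2^m$ elements, viewed as an $m$-dimensional vector space over $\mathbb F_2$, and let $\mathrm{tr}:\mathbb F_{2^m}\to\mathbb F_2$, $\mathrm{tr}(x)=\sum_{i=0}^{m-1}x^{2^i}$, be the trace. A mapping $G:\mathbb F_{2^m}\to\mathbb F_{2^m}$ is called maximum nonlinear (almost bent) if $$\max_{\beta,\gamma\in\mathbb F_{2^m},\ \beta\ne 0}\Bigl|\sum_{x\in\mathbb F_{2^m}}(-1)^{\mathrm{tr}(\gamma x+\beta G(x))}\Bigr| = 2^{(m+1)/2}.$$ For $d\ge 1$ put $D_d=\{x\in\mathbb F_{2^m}:\mathrm{tr}(x^d)=1\}$. A quadric in $\mathbb F_{2^m}$ is the zero set of a polynomial of degree two on this $\mathbb F_2$-vector space, i.e. a set $\{x: Q(x)+\ell(x)+c=0\}$ with $Q$ a nonzero quadratic form, $\ell$ a linear form and $c\in\mathbb F_2$ (it may be degenerate). The only maximum nonlinear power mappings on $\mathbb F_{2^m}$ for which $D_d$ is a quadric are the Gold power mappings with $m$ odd, up to composition with a Frobenius automorphism. Precisely: 1. For every integer $d\ge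 1$: the mapping $x\mapsto x^d$ on $\mathbb F_{2^m}$ is maximum nonlinear and $D_d$ is a quadric if and only if $m$ is odd and there are integers $k,i\ge 0$ with $\gcd(k,m)=1$ such that $x^d=(x^{2^k+1})^{2^i}$ for all $x\in\mathbb F_{2^m}$. 2. For every odd integer $d$ with $1\le d\le 2^m-2$: the mapping $x\mapsto x^d$ is maximum nonlinear and $D_d$ is a quadric if and only if $m$ is odd and $d=2^k+1$ for some integer $k\ge 0$ with $\gcd(k,m)=1$. -/

import Mathlib

/-- The Walsh coefficient `∑ x, (-1) ^ (tr (γ x) + f x)` of a boolean function `f` on a finite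
field `F` of characteristic two. The trace is the absolute trace of `F` over the field with two
elements, and the exponent, an element of that field, is represented by `0` or `1`. -/
noncomputable def walshCoeff {F : Type*} [Field F] [Fintype F] [Algebra (ZMod 2) F]
    (f : F → ZMod 2) (γ : F) : ℤ :=
  ∑ x : F, (-1 : ℤ) ^ (Algebra.trace (ZMod 2) F (γ * x) + f x).val

/-- The linearity of a boolean function: the largest absolute value of a Walsh coefficient. -/
noncomputable def boolLinearity {F : Type*} [Field F] [Fintype F] [Algebra (ZMod 2) F]
    (f : F → ZMod 2) : ℕ :=
  Finset.univ.sup fun γ : F => (walshCoeff f γ).natAbs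

/-- The coordinate function `x ↦ tr (β G(x))` of a mapping `G : F → F`. -/
noncomputable def coordFun {F : Type*} [Field F] [Algebra (ZMod 2) F]
    (G : F → F) (β : F) : F → ZMod 2 :=
  fun x => Algebra.trace (ZMod 2) F (β * G x)

open Classical in
/-- The linearity of `G : F → F`: the largest linearity of a coordinate function with `β ≠ 0`. -/
noncomputable def linearity {F : Type*} [Field F] [Fintype F] [Algebra (ZMod 2) F]
    (G : F → F) : ℕ :=
  (Finset.univ.filter fun β : F => β ≠ 0).sup fun β => boolLinearity (coordFun G β)

/-- A mapping `G` on the field with `2 ^ m` elements is maximum nonlinear (almost bent) if its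
linearity is `2 ^ ((m + 1) / 2)`. The exponent is a real number. -/
def IsMaximumNonlinear {F : Type*} [Field F] [Fintype F] [Algebra (ZMod 2) F]
    (m : ℕ) (G : F → F) : Prop :=
  (linearity G : ℝ) = (2 : ℝ) ^ (((m : ℝ) + 1) / 2)

/-- The set `D_d` of all `x` with `tr (x ^ d) = 1`. -/
def traceOneSet (F : Type*) [Field F] [Algebra (ZMod 2) F] (d : ℕ) : Set F :=
  {x | Algebra.trace (ZMod 2) F (x ^ d) = 1}

/-- A (possibly degenerate, affine) quadric in a vector space `V` over `K`: the zero set of a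
polynomial of degree two, that is, of a function `Q + ℓ + c` with `Q` a nonzero quadratic form,
`ℓ` a linear form and `c` a constant. -/
def IsQuadric (K : Type*) {V : Type*} [Field K] [AddCommGroup V] [Module K V]
    (S : Set V) : Prop :=
  ∃ (Q : QuadraticForm K V) (ℓ : V →ₗ[K] K) (c : K), Q ≠ 0 ∧ S = {x | Q x + ℓ x + c = 0}

/-! If `D_d` is a quadric, `tr (x ^ d)` is a quadratic form, so it is both a sum of characters `x ^
(d * 2 ^ i)` and a combination of characters `x ^ (2 ^ s + 2 ^ t)`. For `m` odd it is nonzero at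
`1`, so by independence of characters the two families meet, and `x ^ d` is a Gold mapping up to
Frobenius (`exists_eq_gold_of_isQuadric`).

For Gold mappings, a squared Walsh coefficient is `0` or `2 ^ m` times the size of the radical
(`walshCoeff_sq_quadraticForm`). If `m` is odd and `gcd(k, m) = 1`, every radical has two elements,
giving `2 ^ (m + 1)`; if the gcd is not `1`, the radical for `β = 1` is too large. Oddness of `m`
follows from the linearity being an integer. -/

theorem neg_one_pow_val_add (a b : ZMod 2) :
    (-1 : ℤ) ^ (a + b).val = (-1) ^ a.val * (-1) ^ b.val := by
  revert a b; decide

theorem neg_one_pow_val_mul_self (a : ZMod 2) : (-1 : ℤ) ^ a.val * (-1) ^ a.val = 1 := by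
  revert a; decide

/-- The sum of the signs of a linear form that does not vanish identically is zero. -/
theorem sum_neg_one_pow_val_eq_zero {M : Type*} [AddCommGroup M] [Fintype M]
    (φ : M →+ ZMod 2) {a : M} (ha : φ a ≠ 0) : ∑ x : M, (-1 : ℤ) ^ (φ x).val = 0 := by
  have h1 : φ a = 1 := by
    revert ha; generalize φ a = t; revert t; decide
  have h : ∑ x : M, (-1 : ℤ) ^ (φ x).val = ∑ x : M, (-1 : ℤ) ^ (φ (x + a)).val :=
    (Equiv.sum_comp (Equiv.addRight a) fun x => (-1 : ℤ) ^ (φ x).val).symm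
  have h2 : ∀ x, (-1 : ℤ) ^ (φ (x + a)).val = -(-1 : ℤ) ^ (φ x).val := by
    intro x
    rw [map_add, neg_one_pow_val_add, h1]
    simp [ZMod.val_one]
  simp only [h2, Finset.sum_neg_distrib] at h
  linarith

theorem sum_neg_one_pow_val_eq_zero_or {M : Type*} [AddCommGroup M] [Fintype M]
    (φ : M →+ ZMod 2) :
    ∑ x : M, (-1 : ℤ) ^ (φ x).val = 0 ∨ ∑ x : M, (-1 : ℤ) ^ (φ x).val = Fintype.card M := by
  by_cases h : ∃ a, φ a ≠ 0
  · obtain ⟨a, ha⟩ := h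
    exact Or.inl (sum_neg_one_pow_val_eq_zero φ ha)
  · push Not at h
    right
    simp [h]

/-! ### Trace, Walsh coefficients and radicals -/

section Field

variable {F : Type*} [Field F] [Fintype F] [Algebra (ZMod 2) F]

theorem exists_trace_mul_ne_zero {a : F} (ha : a ≠ 0) :
    ∃ b : F, Algebra.trace (ZMod 2) F (a * b) ≠ 0 := by
  have htr := (traceForm_nondegenerate (ZMod 2) F).1 a
  simp_rw [Algebra.traceForm_apply] at htr
  by_contra! hf
  exact ha (htr hf)

theorem exists_eq_trace_mul (φ : F →ₗ[ZMod 2] ZMod 2) :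
    ∃ a : F, ∀ x, φ x = Algebra.trace (ZMod 2) F (a * x) :=
  ⟨((Algebra.traceForm (ZMod 2) F).toDual (traceForm_nondegenerate _ _)).symm φ, fun x => by
    rw [← Algebra.traceForm_apply, LinearMap.BilinForm.apply_toDual_symm_apply]⟩

/-- Summed over `γ`, only the terms at `x = 0` survive, leaving `±|F|`. -/
theorem exists_walshCoeff_ne_zero (f : F → ZMod 2) : ∃ γ : F, walshCoeff f γ ≠ 0 := by
  classical
  by_contra! h
  have h1 : ∑ γ : F, walshCoeff f γ = Fintype.card F * (-1 : ℤ) ^ (f 0).val := by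
    simp only [walshCoeff]
    rw [Finset.sum_comm, Finset.sum_eq_single (0 : F)]
    · simp
    · intro x _ hx
      obtain ⟨b, hb⟩ := exists_trace_mul_ne_zero hx
      simp only [neg_one_pow_val_add]
      rw [← Finset.sum_mul]
      have := sum_neg_one_pow_val_eq_zero
        ((Algebra.trace (ZMod 2) F).toAddMonoidHom.comp (AddMonoidHom.mulRight x)) (a := b)
        (by simpa [mul_comm] using hb)
      simp only [AddMonoidHom.comp_apply, AddMonoidHom.coe_mulRight, LinearMap.toAddMonoidHom_coe]
        at this
      rw [this, zero_mul]
    · simp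
  rw [Finset.sum_eq_zero fun γ _ => h γ] at h1
  have h2 : (Fintype.card F : ℤ) ≠ 0 := by exact_mod_cast Fintype.card_ne_zero
  rcases mul_eq_zero.1 h1.symm with h3 | h3
  · exact h2 h3
  · exact pow_ne_zero _ (by norm_num) h3

/-- The square of a Walsh coefficient of a quadratic form is zero or the number of elements of the
field times that of the radical. -/
theorem walshCoeff_sq_quadraticForm (Q : QuadraticForm (ZMod 2) F) (γ : F) :
    walshCoeff Q γ ^ 2 = 0 ∨
      walshCoeff Q γ ^ 2 = Fintype.card F * Nat.card (LinearMap.ker Q.polarBilin) := by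
  classical
  set V := LinearMap.ker Q.polarBilin with hV
  set g : F → ZMod 2 := fun x => Algebra.trace (ZMod 2) F (γ * x) + Q x with hg
  have hadd : ∀ x z, g (z + x) = g z + g x + Q.polarBilin z x := by
    intro x z
    simp only [hg, QuadraticMap.polarBilin_apply_apply, mul_add, map_add,
      QuadraticMap.map_add Q]
    ring
  have hW : walshCoeff Q γ = ∑ x, (-1 : ℤ) ^ (g x).val := rfl
  have h1 : walshCoeff Q γ ^ 2 =
      ∑ z : F, (-1 : ℤ) ^ (g z).val * ∑ x : F, (-1 : ℤ) ^ (Q.polarBilin z x).val := by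
    rw [hW, sq, Finset.sum_mul_sum]
    have : ∀ x : F, ∑ y : F, (-1 : ℤ) ^ (g x).val * (-1 : ℤ) ^ (g y).val =
        ∑ z : F, (-1 : ℤ) ^ (g z).val * (-1 : ℤ) ^ (Q.polarBilin z x).val := by
      intro x
      -- Substituting `y = z + x` turns the product of signs into a sign in `z` times a sign linear
      -- in `x`.
      rw [← Equiv.sum_comp (Equiv.addRight x)]
      refine Finset.sum_congr rfl fun z _ => ?_
      rw [Equiv.coe_addRight, hadd, neg_one_pow_val_add _ (Q.polarBilin z x),
        neg_one_pow_val_add (g z)]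
      linear_combination ((-1 : ℤ) ^ (g z).val * (-1) ^ (Q.polarBilin z x).val) *
        neg_one_pow_val_mul_self (g x)
    rw [Finset.sum_congr rfl fun x _ => this x, Finset.sum_comm]
    simp only [Finset.mul_sum]
  have h2 : ∀ z : F, (-1 : ℤ) ^ (g z).val * ∑ x : F, (-1 : ℤ) ^ (Q.polarBilin z x).val =
      if z ∈ V then (Fintype.card F : ℤ) * (-1) ^ (g z).val else 0 := by
    intro z
    split_ifs with hz
    · have : Q.polarBilin z = 0 := hz
      simp [this, mul_comm]
    · have : ∃ a, Q.polarBilin z a ≠ 0 := by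
        by_contra! h
        exact hz (LinearMap.ext h)
      obtain ⟨a, ha⟩ := this
      have := sum_neg_one_pow_val_eq_zero (Q.polarBilin z).toAddMonoidHom ha
      simp only [LinearMap.toAddMonoidHom_coe] at this
      rw [this, mul_zero]
  have h3 : walshCoeff Q γ ^ 2 = Fintype.card F * ∑ z : V, (-1 : ℤ) ^ (g z).val := by
    rw [h1, Finset.sum_congr rfl fun z _ => h2 z, ← Finset.sum_filter, ← Finset.mul_sum]
    congr 1
    exact Finset.sum_subtype _ (by simp) fun z => (-1 : ℤ) ^ (g z).val
  let φ : V →+ ZMod 2 :=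
    { toFun := fun z => g z
      map_zero' := by simp [hg]
      map_add' := fun a b => by
        have : Q.polarBilin a = 0 := a.2
        rw [Submodule.coe_add, hadd, this]
        simp }
  rcases sum_neg_one_pow_val_eq_zero_or φ with h | h
  · left
    rw [h3]
    exact mul_eq_zero_of_right _ h
  · right
    rw [h3, Nat.card_eq_fintype_card]
    exact congrArg _ h

theorem trace_pow_two_pow (x : F) (k : ℕ) :
    Algebra.trace (ZMod 2) F (x ^ 2 ^ k) = Algebra.trace (ZMod 2) F x := by
  have h := Algebra.trace_eq_of_algEquiv
    (FiniteField.frobeniusAlgEquivOfAlgebraic (ZMod 2) F ^ k) x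
  rwa [AlgEquiv.coe_pow, FiniteField.coe_frobeniusAlgEquivOfAlgebraic_iterate, ZMod.card] at h

theorem finrank_eq_of_card {m : ℕ} (hF : Fintype.card F = 2 ^ m) :
    Module.finrank (ZMod 2) F = m := by
  have h := Module.card_eq_pow_finrank (K := ZMod 2) (V := F)
  rw [hF, ZMod.card] at h
  exact (Nat.pow_right_injective le_rfl h).symm

theorem trace_one_of_odd {m : ℕ} (hF : Fintype.card F = 2 ^ m) (hm : Odd m) :
    Algebra.trace (ZMod 2) F 1 = 1 := by
  have h := Algebra.trace_algebraMap (S := F) (1 : ZMod 2)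
  rw [map_one, finrank_eq_of_card hF] at h
  rw [h, nsmul_one]
  exact (ZMod.natCast_eq_one_iff_odd).2 hm

theorem trace_eq_sum_pow {m : ℕ} (hF : Fintype.card F = 2 ^ m) (x : F) :
    algebraMap (ZMod 2) F (Algebra.trace (ZMod 2) F x) = ∑ i ∈ Finset.range m, x ^ 2 ^ i := by
  rw [FiniteField.algebraMap_trace_eq_sum_pow, finrank_eq_of_card hF, Nat.card_zmod]

end Field

/-! ### Gold forms and their radicals -/

section Gold

variable {F : Type*} [Field F] [Fintype F] [Algebra (ZMod 2) F]

/-- The quadratic form `x ↦ tr (β x ^ (2 ^ k + 1))`. -/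
noncomputable def goldForm (β : F) (k : ℕ) : QuadraticForm (ZMod 2) F :=
  LinearMap.BilinMap.toQuadraticMap
    ((Algebra.traceForm (ZMod 2) F).compLeft ((LinearMap.mulLeft (ZMod 2) β).comp
      (FiniteField.frobeniusAlgEquivOfAlgebraic (ZMod 2) F ^ k).toLinearMap))

theorem frobenius_pow_apply (k : ℕ) (x : F) :
    (FiniteField.frobeniusAlgEquivOfAlgebraic (ZMod 2) F ^ k) x = x ^ 2 ^ k := by
  rw [AlgEquiv.coe_pow, FiniteField.coe_frobeniusAlgEquivOfAlgebraic_iterate, ZMod.card]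

theorem pow_two_pow_surjective (k : ℕ) : Function.Surjective fun x : F => x ^ 2 ^ k := fun y =>
  ⟨(FiniteField.frobeniusAlgEquivOfAlgebraic (ZMod 2) F ^ k).symm y, by
    simp only [← frobenius_pow_apply, AlgEquiv.apply_symm_apply]⟩

theorem goldForm_apply (β : F) (k : ℕ) (x : F) :
    goldForm β k x = Algebra.trace (ZMod 2) F (β * x ^ (2 ^ k + 1)) := by
  simp only [goldForm, LinearMap.BilinMap.toQuadraticMap_apply, LinearMap.BilinForm.compLeft_apply,
    LinearMap.comp_apply, AlgEquiv.toLinearMap_apply, frobenius_pow_apply, LinearMap.mulLeft_apply,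
    Algebra.traceForm_apply, pow_succ, mul_assoc]

/-- Frobenius invariance of the trace collects both polar terms on `x ^ 2 ^ k`, so the radical is
cut out by a single equation in `z`. -/
theorem goldForm_polarBilin (β : F) (k : ℕ) (z x : F) :
    (goldForm β k).polarBilin z x =
      Algebra.trace (ZMod 2) F (((β * z ^ 2 ^ k) ^ 2 ^ k + β * z) * x ^ 2 ^ k) := by
  rw [QuadraticMap.polarBilin_apply_apply, goldForm, LinearMap.BilinMap.polar_toQuadraticMap,
    add_mul, map_add, ← mul_pow, trace_pow_two_pow]
  simp only [LinearMap.BilinForm.compLeft_apply, LinearMap.comp_apply, AlgEquiv.toLinearMap_apply,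
    frobenius_pow_apply, LinearMap.mulLeft_apply, Algebra.traceForm_apply]
  congr 2
  ring

theorem charP_two_of_algebra (F : Type*) [Field F] [Algebra (ZMod 2) F] : CharP F 2 :=
  charP_of_injective_algebraMap (algebraMap (ZMod 2) F).injective 2

theorem mem_ker_goldForm (β : F) (k : ℕ) (z : F) :
    z ∈ LinearMap.ker (goldForm β k).polarBilin ↔ (β * z ^ 2 ^ k) ^ 2 ^ k = β * z := by
  have := charP_two_of_algebra F
  rw [← CharTwo.add_eq_zero]
  constructor
  · intro h
    by_contra h0
    obtain ⟨b, hb⟩ := exists_trace_mul_ne_zero h0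
    obtain ⟨x, rfl⟩ := pow_two_pow_surjective k b
    refine hb ?_
    rw [← goldForm_polarBilin]
    exact LinearMap.congr_fun h x
  · intro h
    refine LinearMap.ext fun x => ?_
    rw [goldForm_polarBilin, h]
    simp

theorem pow_card_sub_one_eq_one_of_card {F : Type*} [Field F] [Fintype F] {m : ℕ}
    (hF : Fintype.card F = 2 ^ m) {x : F} (hx : x ≠ 0) : x ^ (2 ^ m - 1) = 1 := by
  rw [← hF]
  exact FiniteField.pow_card_sub_one_eq_one x hx

theorem pow_sub_one_eq_one_iff {F : Type*} [Field F] {n : ℕ} (hn : n ≠ 0) {x : F} (hx : x ≠ 0) :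
    x ^ (n - 1) = 1 ↔ x ^ n = x := by
  obtain ⟨n, rfl⟩ := Nat.exists_eq_succ_of_ne_zero hn
  rw [Nat.succ_sub_one, pow_succ, mul_eq_right₀ hx]

theorem eq_zero_or_one_of_pow_two_pow_eq_self {F : Type*} [Field F] [Fintype F]
    {m k : ℕ} (hF : Fintype.card F = 2 ^ m)
    (hk : Nat.gcd k m = 1) {x : F} (hx : x ^ 2 ^ k = x) : x = 0 ∨ x = 1 := by
  refine or_iff_not_imp_left.2 fun h0 => ?_
  have h := pow_gcd_eq_one.2 ⟨(pow_sub_one_eq_one_iff (pow_ne_zero k two_ne_zero) h0).2 hx,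
    pow_card_sub_one_eq_one_of_card hF h0⟩
  rwa [Nat.pow_sub_one_gcd_pow_sub_one, hk, pow_one, pow_one] at h

/-- A quotient `v` of two points with equal nonzero image satisfies `v ^ 2 ^ k = v⁻¹`, so it is
fixed by the power `2 ^ (2 * k)`; since `2 * k` is coprime to the odd `m`, `v = 1`. -/
theorem gold_injective {F : Type*} [Field F] [Fintype F] {m k : ℕ}
    (hF : Fintype.card F = 2 ^ m) (hm : Odd m) (hk : Nat.gcd k m = 1) : Function.Injective fun x : F => x ^ (2 ^ k + 1) := by
  intro x y (hxy : x ^ _ = y ^ _)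
  rcases eq_or_ne y 0 with rfl | hy
  · rw [zero_pow (Nat.succ_ne_zero _)] at hxy
    exact (pow_eq_zero_iff (Nat.succ_ne_zero _)).1 hxy
  · have hv : (x / y) ^ (2 ^ k + 1) = 1 := by
      rw [div_pow, hxy, div_self (pow_ne_zero _ hy)]
    have hv0 : x / y ≠ 0 := by
      intro h
      rw [h, zero_pow (Nat.succ_ne_zero _)] at hv
      exact zero_ne_one hv
    have h1 : (x / y) ^ 2 ^ k = (x / y)⁻¹ := eq_inv_of_mul_eq_one_left (by rw [← pow_succ, hv])
    have h2 : (x / y) ^ 2 ^ (2 * k) = x / y := by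
      rw [two_mul, pow_add, pow_mul, h1, inv_pow, h1, inv_inv]
    have h3 : Nat.gcd (2 * k) m = 1 :=
      Nat.Coprime.mul_left (Nat.coprime_two_left.2 hm) hk
    rcases eq_zero_or_one_of_pow_two_pow_eq_self hF h3 h2 with h | h
    · exact absurd h hv0
    · exact (div_eq_one_iff_eq hy).1 h

theorem card_ker_goldForm {m k : ℕ} (hF : Fintype.card F = 2 ^ m) (hm : Odd m)
    (hk : Nat.gcd k m = 1) {β : F} (hβ : β ≠ 0) :
    Nat.card (LinearMap.ker (goldForm β k).polarBilin) = 2 := by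
  obtain ⟨w, hw⟩ := Finite.surjective_of_injective (gold_injective hF hm hk) β⁻¹
  have hw' : w ^ 2 ^ k * w = β⁻¹ := by rw [← pow_succ]; exact hw
  have hw0 : w ≠ 0 := by
    rintro rfl
    rw [mul_zero] at hw'
    exact inv_ne_zero hβ hw'.symm
  have : ((LinearMap.ker (goldForm β k).polarBilin : Submodule (ZMod 2) F) : Set F) = {0, w} := by
    ext z
    rw [SetLike.mem_coe, mem_ker_goldForm]
    constructor
    · intro h
      refine or_iff_not_imp_left.2 fun hz => ?_
      -- The radical equation makes `β * z ^ (2 ^ k + 1)` Frobenius-fixed, hence `1`; injectivity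
      -- then gives `z = w`.
      have h1 : (β * (z ^ 2 ^ k * z)) ^ 2 ^ k = β * (z ^ 2 ^ k * z) := by
        rw [← mul_assoc, mul_pow, h]
        ring
      rcases eq_zero_or_one_of_pow_two_pow_eq_self hF hk h1 with h2 | h2
      · exact absurd h2 (mul_ne_zero hβ (mul_ne_zero (pow_ne_zero _ hz) hz))
      · refine gold_injective hF hm hk ?_
        change z ^ (2 ^ k + 1) = w ^ (2 ^ k + 1)
        rw [pow_succ, pow_succ, hw']
        exact eq_inv_of_mul_eq_one_right h2
    · rintro (rfl | rfl)
      · simp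
      · have h1 : β * z ^ 2 ^ k = z⁻¹ := eq_inv_of_mul_eq_one_left (by
          rw [mul_assoc, hw', mul_inv_cancel₀ hβ])
        have h2 : β * z * z ^ 2 ^ k = 1 := by rw [mul_right_comm, h1, inv_mul_cancel₀ hw0]
        rw [h1, inv_pow]
        exact (eq_inv_of_mul_eq_one_left h2).symm
  rw [← SetLike.coe_sort_coe, this, Nat.card_coe_set_eq, Set.ncard_pair hw0.symm]

theorem exists_pow_two_pow_gcd_eq_self {F : Type*} [Field F] [Fintype F]
    {m : ℕ} (k : ℕ) (hF : Fintype.card F = 2 ^ m)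
    (hm : m ≠ 0) (hk : Nat.gcd k m ≠ 1) :
    ∃ z : F, z ≠ 0 ∧ z ≠ 1 ∧ z ^ 2 ^ k = z := by
  obtain ⟨g, hg⟩ := IsCyclic.exists_ofOrder_eq_natCard (α := Fˣ)
  rw [Nat.card_units, Nat.card_eq_fintype_card, hF] at hg
  have hD := Nat.pow_sub_one_gcd_pow_sub_one 2 k m
  have hDm : 2 ^ Nat.gcd k m - 1 ∣ 2 ^ m - 1 := hD ▸ Nat.gcd_dvd_right _ _
  have hDk : 2 ^ Nat.gcd k m - 1 ∣ 2 ^ k - 1 := hD ▸ Nat.gcd_dvd_left _ _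
  have he : 2 ≤ Nat.gcd k m := by
    have := Nat.gcd_pos_of_pos_right k (Nat.pos_of_ne_zero hm)
    omega
  have h4 : 2 ^ 2 ≤ 2 ^ Nat.gcd k m := Nat.pow_le_pow_right two_pos he
  have hN : 0 < 2 ^ m - 1 := by
    have := Nat.one_lt_two_pow hm
    omega
  obtain ⟨C, hC⟩ := hDm
  have hC0 : 0 < C := by
    rcases Nat.eq_zero_or_pos C with rfl | h
    · omega
    · exact h
  obtain ⟨E, hE⟩ := hDk
  -- With `C = (2 ^ m - 1) / (2 ^ gcd - 1)`, this power of the generator has order `2 ^ gcd - 1 ≥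
  -- 3`.
  refine ⟨((g ^ C : Fˣ) : F), Units.ne_zero _, ?_, ?_⟩
  · intro h
    rw [Units.val_eq_one] at h
    have h1 := Nat.le_of_dvd hC0 (hg ▸ orderOf_dvd_of_pow_eq_one h)
    nlinarith [show 3 ≤ 2 ^ Nat.gcd k m - 1 by omega]
  · rw [← pow_sub_one_eq_one_iff (pow_ne_zero k two_ne_zero) (Units.ne_zero _), hE,
      ← Units.val_pow_eq_pow_val, ← pow_mul, ← mul_assoc, mul_comm C, ← hC, pow_mul, ← hg,
      pow_orderOf_eq_one, one_pow, Units.val_one]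

theorem two_lt_card_ker_goldForm_one {m : ℕ} (k : ℕ) (hF : Fintype.card F = 2 ^ m)
    (hm : m ≠ 0) (hk : Nat.gcd k m ≠ 1) :
    2 < Nat.card (LinearMap.ker (goldForm (1 : F) k).polarBilin) := by
  obtain ⟨z, hz0, hz1, hz⟩ := exists_pow_two_pow_gcd_eq_self (F := F) k hF hm hk
  rw [← SetLike.coe_sort_coe, Nat.card_coe_set_eq, Set.two_lt_ncard]
  refine ⟨0, Submodule.zero_mem _, 1, ?_, z, ?_, zero_ne_one, hz0.symm, hz1.symm⟩
  · rw [SetLike.mem_coe, mem_ker_goldForm]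
    simp
  · rw [SetLike.mem_coe, mem_ker_goldForm]
    simp [hz]

end Gold

/-! ### Linearity of Gold mappings -/

section Linearity

variable {F : Type*} [Field F] [Fintype F] [Algebra (ZMod 2) F]

theorem isMaximumNonlinear_iff {m : ℕ} {G : F → F} :
    IsMaximumNonlinear m G ↔ linearity G ^ 2 = 2 ^ (m + 1) := by
  have h : ((2 : ℝ) ^ (((m : ℝ) + 1) / 2)) ^ 2 = 2 ^ (m + 1) := by
    rw [← Real.rpow_natCast, ← Real.rpow_mul two_pos.le, ← Real.rpow_natCast]
    congr 1
    push_cast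
    ring
  rw [IsMaximumNonlinear, ← sq_eq_sq₀ (Nat.cast_nonneg _) (by positivity), h]
  exact_mod_cast Iff.rfl

theorem IsMaximumNonlinear.odd {m : ℕ} {G : F → F} (h : IsMaximumNonlinear m G) : Odd m := by
  rw [isMaximumNonlinear_iff] at h
  obtain ⟨j, -, hj⟩ := (Nat.dvd_prime_pow Nat.prime_two).1 (h ▸ dvd_pow_self _ two_ne_zero)
  rw [hj, ← pow_mul] at h
  have := Nat.pow_right_injective le_rfl h
  exact ⟨j - 1, by omega⟩

theorem walshCoeff_sq_le_linearity_sq (G : F → F) {β : F} (hβ : β ≠ 0) (γ : F) :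
    walshCoeff (coordFun G β) γ ^ 2 ≤ (linearity G : ℤ) ^ 2 := by
  classical
  have h1 : (walshCoeff (coordFun G β) γ).natAbs ≤ boolLinearity (coordFun G β) :=
    Finset.le_sup (f := fun γ => (walshCoeff (coordFun G β) γ).natAbs) (Finset.mem_univ γ)
  have h2 : boolLinearity (coordFun G β) ≤ linearity G :=
    Finset.le_sup (f := fun β => boolLinearity (coordFun G β)) (by simpa using hβ)
  rw [← Int.natAbs_sq]
  exact_mod_cast Nat.pow_le_pow_left (h1.trans h2) 2

theorem exists_linearity_sq_eq (G : F → F) :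
    ∃ β γ : F, β ≠ 0 ∧ (linearity G : ℤ) ^ 2 = walshCoeff (coordFun G β) γ ^ 2 := by
  classical
  obtain ⟨β, hβ, h1⟩ := Finset.exists_mem_eq_sup (Finset.univ.filter fun β : F => β ≠ 0)
    ⟨1, by simp⟩ fun β => boolLinearity (coordFun G β)
  obtain ⟨γ, -, h2⟩ := Finset.exists_mem_eq_sup (Finset.univ : Finset F) ⟨0, by simp⟩
    fun γ => (walshCoeff (coordFun G β) γ).natAbs
  refine ⟨β, γ, by simpa using hβ, ?_⟩
  have h3 : linearity G = boolLinearity (coordFun G β) := h1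
  rw [← Int.natAbs_sq (walshCoeff _ _), ← h2, h3, boolLinearity]

variable {m k i : ℕ} {G : F → F}

theorem isMaximumNonlinear_of_gold (hF : Fintype.card F = 2 ^ m) (hm : Odd m)
    (hk : Nat.gcd k m = 1) (hG : ∀ x, G x = (x ^ (2 ^ k + 1)) ^ 2 ^ i) :
    IsMaximumNonlinear m G := by
  have hcoord : ∀ β : F, β ≠ 0 → ∃ β' : F, β' ≠ 0 ∧ coordFun G β = goldForm β' k := by
    intro β hβ
    obtain ⟨β', rfl⟩ := pow_two_pow_surjective i β
    refine ⟨β', fun h => hβ (by simp [h]), funext fun x => ?_⟩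
    rw [goldForm_apply, coordFun, hG, ← mul_pow, trace_pow_two_pow]
  have hsq : ∀ β γ : F, β ≠ 0 → walshCoeff (coordFun G β) γ ^ 2 = 0 ∨
      walshCoeff (coordFun G β) γ ^ 2 = 2 ^ (m + 1) := by
    intro β γ hβ
    obtain ⟨β', hβ', h⟩ := hcoord β hβ
    rw [h]
    have := walshCoeff_sq_quadraticForm (goldForm β' k) γ
    rw [card_ker_goldForm hF hm hk hβ', hF] at this
    rw [pow_succ (2 : ℤ)]
    exact_mod_cast this
  rw [isMaximumNonlinear_iff]
  obtain ⟨β, γ, hβ, h⟩ := exists_linearity_sq_eq G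
  rcases hsq β γ hβ with h0 | h0
  -- Linearity zero would kill every Walsh coefficient.
  · obtain ⟨δ, hδ⟩ := exists_walshCoeff_ne_zero (coordFun G 1)
    have := walshCoeff_sq_le_linearity_sq G one_ne_zero δ
    rw [h, h0] at this
    exact absurd this (not_le.2 (by positivity))
  · rw [h0] at h
    exact_mod_cast h

theorem IsMaximumNonlinear.gcd_eq_one (hF : Fintype.card F = 2 ^ m)
    (hG : ∀ x, G x = (x ^ (2 ^ k + 1)) ^ 2 ^ i) (h : IsMaximumNonlinear m G) :
    Nat.gcd k m = 1 := by
  by_contra hk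
  have hcard := two_lt_card_ker_goldForm_one (F := F) k hF h.odd.pos.ne' hk
  have hcoord : coordFun G 1 = goldForm 1 k := funext fun x => by
    rw [goldForm_apply, coordFun, hG, one_mul, one_mul, trace_pow_two_pow]
  obtain ⟨δ, hδ⟩ := exists_walshCoeff_ne_zero (coordFun G 1)
  have h1 := walshCoeff_sq_le_linearity_sq G one_ne_zero δ
  have h2 : (linearity G : ℤ) ^ 2 = 2 ^ (m + 1) := by
    exact_mod_cast isMaximumNonlinear_iff.1 h
  rw [h2] at h1
  rw [hcoord] at h1 hδ
  rcases walshCoeff_sq_quadraticForm (goldForm (1 : F) k) δ with h3 | h3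
  · exact pow_ne_zero 2 hδ h3
  · rw [h3, hF, pow_succ] at h1
    norm_cast at h1
    have h4 := Nat.le_of_mul_le_mul_left h1 (by positivity)
    omega

end Linearity

/-! ### Quadrics and independence of characters -/

section Quadric

variable {F : Type*} [Field F] [Fintype F] [Algebra (ZMod 2) F]

/-- If `D_d` is a quadric, then `x ↦ tr (x ^ d)` is a quadratic form, because linear forms over the
field with two elements are squares of themselves. -/
theorem exists_quadraticForm_of_isQuadric {F : Type*} [Field F] [Algebra (ZMod 2) F] {d : ℕ}
    (hd : 1 ≤ d)
    (h : IsQuadric (ZMod 2) (traceOneSet F d)) :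
    ∃ Q : QuadraticForm (ZMod 2) F, ∀ x, Algebra.trace (ZMod 2) F (x ^ d) = Q x := by
  obtain ⟨Q, ℓ, c, -, h⟩ := h
  have hx : ∀ x, Algebra.trace (ZMod 2) F (x ^ d) = 1 ↔ Q x + ℓ x + c = 0 := fun x =>
    Set.ext_iff.1 h x
  have hc : c = 1 := by
    have h0 := hx 0
    rw [zero_pow (by omega)] at h0
    simp only [map_zero, zero_add, zero_ne_one, false_iff] at h0
    clear h hx
    revert h0 c; decide
  subst hc
  refine ⟨Q + QuadraticMap.linMulLin ℓ ℓ, fun x => ?_⟩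
  rw [add_apply, QuadraticMap.linMulLin_apply]
  have := hx x
  revert this
  generalize Algebra.trace (ZMod 2) F (x ^ d) = a
  generalize Q x = b
  generalize ℓ x = e
  revert a b e; decide

/-- Expand one argument of a bilinear form inducing `Q` in a basis; the coordinates and the `B (e
i)` are linear, hence traces. -/
theorem exists_quadraticForm_eq_sum_trace_mul_trace (Q : QuadraticForm (ZMod 2) F) :
    ∃ (n : ℕ) (a b : Fin n → F), ∀ x, Q x = ∑ i, Algebra.trace (ZMod 2) F (a i * x) *
      Algebra.trace (ZMod 2) F (b i * x) := by
  obtain ⟨B, rfl⟩ := LinearMap.BilinMap.toQuadraticMap_surjective Q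
  let e := Module.finBasis (ZMod 2) F
  choose a ha using fun i => exists_eq_trace_mul (e.coord i)
  choose b hb using fun i => exists_eq_trace_mul (B (e i))
  refine ⟨_, a, b, fun x => ?_⟩
  have hx : B x = B (∑ i, e.repr x i • e i) := by rw [e.sum_repr]
  rw [LinearMap.BilinMap.toQuadraticMap_apply, hx, map_sum, LinearMap.sum_apply]
  refine Finset.sum_congr rfl fun i _ => ?_
  rw [map_smul, LinearMap.smul_apply, smul_eq_mul, ← ha, hb, e.coord_apply]

/-- The character `u ↦ u ^ n` of the multiplicative group. -/
def unitsPowHom (F : Type*) [Field F] (n : ℕ) : Fˣ →* F := (Units.coeHom F).comp (powMonoidHom n)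

theorem unitsPowHom_apply {F : Type*} [Field F] (n : ℕ) (u : Fˣ) :
    unitsPowHom F n u = (u : F) ^ n := by
  simp [unitsPowHom]

theorem exists_pow_eq_of_trace_pow_eq_quadraticForm {m d : ℕ} (hF : Fintype.card F = 2 ^ m)
    (hm : Odd m) (hd : 1 ≤ d) {Q : QuadraticForm (ZMod 2) F}
    (hQ : ∀ x, Algebra.trace (ZMod 2) F (x ^ d) = Q x) :
    ∃ i s t : ℕ, ∀ x : F, x ^ (d * 2 ^ i) = x ^ (2 ^ s + 2 ^ t) := by
  obtain ⟨n, a, b, hab⟩ := exists_quadraticForm_eq_sum_trace_mul_trace Q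
  let Φ : Fˣ → F := fun u => algebraMap (ZMod 2) F (Algebra.trace (ZMod 2) F ((u : F) ^ d))
  let A : Set (Fˣ →* F) := Set.range fun i : ℕ => unitsPowHom F (d * 2 ^ i)
  let E : Set (Fˣ →* F) := Set.range fun p : ℕ × ℕ => unitsPowHom F (2 ^ p.1 + 2 ^ p.2)
  have hΦA : Φ ∈ Submodule.span F ((fun f : Fˣ →* F => (f : Fˣ → F)) '' A) := by
    have : Φ = ∑ i ∈ Finset.range m, ⇑(unitsPowHom F (d * 2 ^ i)) := by
      funext u
      simp only [Φ, trace_eq_sum_pow hF, Finset.sum_apply, unitsPowHom_apply, pow_mul]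
    rw [this]
    exact Submodule.sum_mem _ fun i _ => Submodule.subset_span ⟨_, ⟨i, rfl⟩, rfl⟩
  have hΦE : Φ ∈ Submodule.span F ((fun f : Fˣ →* F => (f : Fˣ → F)) '' E) := by
    have : Φ = ∑ j, ∑ s ∈ Finset.range m, ∑ t ∈ Finset.range m,
        (a j ^ 2 ^ s * b j ^ 2 ^ t) • ⇑(unitsPowHom F (2 ^ s + 2 ^ t)) := by
      funext u
      simp only [Φ, hQ, hab, map_sum, map_mul, trace_eq_sum_pow hF, Finset.sum_apply,
        Pi.smul_apply, smul_eq_mul, unitsPowHom_apply, Finset.sum_mul_sum]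
      refine Finset.sum_congr rfl fun j _ => Finset.sum_congr rfl fun s _ =>
        Finset.sum_congr rfl fun t _ => ?_
      ring
    rw [this]
    exact Submodule.sum_mem _ fun j _ => Submodule.sum_mem _ fun s _ => Submodule.sum_mem _
      fun t _ => Submodule.smul_mem _ _ (Submodule.subset_span ⟨_, ⟨(s, t), rfl⟩, rfl⟩)
  have hdisj : ¬ Disjoint A E := by
    intro h
    have h0 := Submodule.disjoint_def.1
      ((linearIndependent_monoidHom Fˣ F).disjoint_span_image h) Φ hΦA hΦE
    have h1 := congrFun h0 1
    simp only [Φ, Units.val_one, one_pow, trace_one_of_odd hF hm, map_one, Pi.zero_apply,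
      one_ne_zero] at h1
  obtain ⟨_, ⟨i, rfl⟩, ⟨⟨s, t⟩, h⟩⟩ := Set.not_disjoint_iff.1 hdisj
  refine ⟨i, s, t, fun x => ?_⟩
  rcases eq_or_ne x 0 with rfl | hx
  · rw [zero_pow (by positivity), zero_pow (by positivity)]
  · have := DFunLike.congr_fun h (Units.mk0 x hx)
    simpa [unitsPowHom_apply] using this.symm

theorem pow_two_pow_mul_eq_self {F : Type*} [Field F] [Fintype F] {m : ℕ}
    (hF : Fintype.card F = 2 ^ m) (n : ℕ) (x : F) : x ^ 2 ^ (m * n) = x := by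
  rw [pow_mul, ← hF, FiniteField.pow_card_pow]

theorem pow_two_pow_mod {F : Type*} [Field F] [Fintype F] {m : ℕ}
    (hF : Fintype.card F = 2 ^ m) (n : ℕ) (x : F) : x ^ 2 ^ (n % m) = x ^ 2 ^ n := by
  conv_rhs => rw [← Nat.div_add_mod n m, pow_add, pow_mul, pow_two_pow_mul_eq_self hF]

theorem exists_eq_gold_of_isQuadric {m d : ℕ} (hF : Fintype.card F = 2 ^ m)
    (hm : Odd m) (hd : 1 ≤ d) (h : IsQuadric (ZMod 2) (traceOneSet F d)) :
    ∃ k i : ℕ, ∀ x : F, x ^ d = (x ^ (2 ^ k + 1)) ^ 2 ^ i := by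
  obtain ⟨Q, hQ⟩ := exists_quadraticForm_of_isQuadric hd h
  obtain ⟨i, s, t, h⟩ := exists_pow_eq_of_trace_pow_eq_quadraticForm hF hm hd hQ
  wlog hst : t ≤ s generalizing s t
  · exact this t s (fun x => by rw [h, add_comm]) (le_of_not_ge hst)
  obtain ⟨k, rfl⟩ := Nat.exists_eq_add_of_le hst
  -- Since `i + i * (m - 1) = m * i`, `i * (m - 1)` further Frobenius steps undo the first `i`.
  refine ⟨k, t + i * (m - 1), fun x => ?_⟩
  have hi : i + i * (m - 1) = m * i := by
    obtain ⟨n, rfl⟩ := Nat.exists_eq_succ_of_ne_zero hm.pos.ne'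
    rw [Nat.succ_sub_one, Nat.succ_eq_add_one]
    ring
  calc x ^ d = (x ^ (d * 2 ^ i)) ^ 2 ^ (i * (m - 1)) := by
        rw [pow_mul, ← pow_mul _ (2 ^ i), ← pow_add, hi, pow_two_pow_mul_eq_self hF]
    _ = (x ^ (2 ^ k + 1)) ^ 2 ^ (t + i * (m - 1)) := by
        rw [h, ← pow_mul, ← pow_mul]
        congr 1
        ring

theorem isQuadric_traceOneSet_of_gold {m d k i : ℕ} (hF : Fintype.card F = 2 ^ m) (hm : Odd m)
    (h : ∀ x : F, x ^ d = (x ^ (2 ^ k + 1)) ^ 2 ^ i) :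
    IsQuadric (ZMod 2) (traceOneSet F d) := by
  refine ⟨goldForm 1 k, 0, 1, fun h0 => ?_, Set.ext fun x => ?_⟩
  · have h1 := goldForm_apply (1 : F) k 1
    rw [h0, one_pow, one_mul, trace_one_of_odd hF hm] at h1
    exact zero_ne_one h1
  · rw [traceOneSet, Set.mem_ofPred_eq, Set.mem_ofPred_eq, h, trace_pow_two_pow, goldForm_apply,
      one_mul, LinearMap.zero_apply, add_zero, CharTwo.add_eq_zero]

end Quadric

/-! ### Odd exponents modulo `2 ^ m - 1` -/

section Exponents

theorem two_pow_add_two_pow_lt {m s t : ℕ} (hm : 3 ≤ m) (hs : s < m) (hst : t < s) :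
    2 ^ s + 2 ^ t < 2 ^ m - 1 := by
  obtain ⟨n, rfl⟩ := Nat.exists_eq_add_of_le hm
  have h1 : 2 ^ s ≤ 2 ^ (n + 2) := Nat.pow_le_pow_right two_pos (by omega)
  have h2 : 2 ^ t ≤ 2 ^ (n + 1) := Nat.pow_le_pow_right two_pos (by omega)
  have h3 : 2 ^ (3 + n) = 8 * 2 ^ n := by ring
  have h4 : 2 ^ (n + 2) = 4 * 2 ^ n := by ring
  have h5 : 2 ^ (n + 1) = 2 * 2 ^ n := by ring
  have := Nat.one_le_two_pow (n := n)
  omega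

theorem eq_two_pow_add_one_of_modEq {m d s t : ℕ} (hd : Odd d) (hdm : d < 2 ^ m - 1)
    (hm : 3 ≤ m) (hs : s < m) (hst : t < s) (h : d ≡ 2 ^ s + 2 ^ t [MOD 2 ^ m - 1]) :
    d = 2 ^ s + 1 := by
  have h1 := h.eq_of_lt_of_lt hdm (two_pow_add_two_pow_lt hm hs hst)
  rcases Nat.eq_zero_or_pos t with rfl | ht
  · rw [h1, pow_zero]
  -- With `0 < t < s` both powers of two are even.
  · refine absurd hd (Nat.not_odd_iff_even.2 ?_)
    rw [h1]
    exact (even_two.pow_of_ne_zero (by omega)).add (even_two.pow_of_ne_zero (by omega))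

theorem exists_eq_two_pow_add_one {F : Type*} [Field F] [Fintype F] {m d k i : ℕ}
    (hF : Fintype.card F = 2 ^ m) (hm : Odd m) (hd : Odd d) (hdm : d < 2 ^ m - 1)
    (hk : Nat.gcd k m = 1) (h : ∀ x : F, x ^ d = (x ^ (2 ^ k + 1)) ^ 2 ^ i) :
    ∃ j, d = 2 ^ j + 1 := by
  have hm1 : m ≠ 1 := by
    rintro rfl
    have := hd.pos
    omega
  have hm3 : 3 ≤ m := by
    obtain ⟨n, rfl⟩ := hm
    omega
  obtain ⟨g, hg⟩ := IsCyclic.exists_ofOrder_eq_natCard (α := Fˣ)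
  rw [Nat.card_units, Nat.card_eq_fintype_card, hF] at hg
  have hmod : d ≡ 2 ^ ((k + i) % m) + 2 ^ (i % m) [MOD 2 ^ m - 1] := by
    rw [← hg, ← pow_eq_pow_iff_modEq, Units.ext_iff, Units.val_pow_eq_pow_val,
      Units.val_pow_eq_pow_val, h, pow_add (g : F) (2 ^ (_ % _)), pow_two_pow_mod hF,
      pow_two_pow_mod hF]
    ring
  have hm0 : 0 < m := by omega
  rcases lt_trichotomy ((k + i) % m) (i % m) with hlt | heq | hlt
  · exact ⟨_, eq_two_pow_add_one_of_modEq hd hdm hm3 (Nat.mod_lt _ hm0) hlt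
      (by rwa [add_comm])⟩
  · have hmk : m ∣ k := by
      have h1 : i ≡ k + i [MOD m] := heq.symm
      simpa using (Nat.modEq_iff_dvd' (Nat.le_add_left i k)).1 h1
    rw [Nat.gcd_eq_right hmk] at hk
    exact absurd hk hm1
  · exact ⟨_, eq_two_pow_add_one_of_modEq hd hdm hm3 (Nat.mod_lt _ hm0) hlt hmod⟩

end Exponents

/-! ### The classification -/

theorem mainTheorem3 (m : ℕ) (F : Type*) [Field F] [Fintype F] [Algebra (ZMod 2) F]
    (hF : Fintype.card F = 2 ^ m) :
    (∀ d : ℕ, 1 ≤ d →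
      ((IsMaximumNonlinear m (fun x : F => x ^ d) ∧ IsQuadric (ZMod 2) (traceOneSet F d)) ↔
        Odd m ∧ ∃ k i : ℕ, Nat.gcd k m = 1 ∧ ∀ x : F, x ^ d = (x ^ (2 ^ k + 1)) ^ (2 ^ i))) ∧
    (∀ d : ℕ, Odd d → d < 2 ^ m - 1 →
      ((IsMaximumNonlinear m (fun x : F => x ^ d) ∧ IsQuadric (ZMod 2) (traceOneSet F d)) ↔
        Odd m ∧ ∃ k : ℕ, Nat.gcd k m = 1 ∧ d = 2 ^ k + 1)) := by
  have key : ∀ d : ℕ, 1 ≤ d →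
      ((IsMaximumNonlinear m (fun x : F => x ^ d) ∧ IsQuadric (ZMod 2) (traceOneSet F d)) ↔
        Odd m ∧ ∃ k i : ℕ, Nat.gcd k m = 1 ∧
          ∀ x : F, x ^ d = (x ^ (2 ^ k + 1)) ^ (2 ^ i)) := by
    intro d hd
    constructor
    · rintro ⟨hN, hQ⟩
      obtain ⟨k, i, h⟩ := exists_eq_gold_of_isQuadric hF hN.odd hd hQ
      exact ⟨hN.odd, k, i, hN.gcd_eq_one hF h, h⟩
    · rintro ⟨hm, k, i, hk, h⟩
      exact ⟨isMaximumNonlinear_of_gold hF hm hk h, isQuadric_traceOneSet_of_gold hF hm h⟩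
  refine ⟨key, fun d hd hdm => ⟨fun h => ?_, ?_⟩⟩
  · obtain ⟨hm, k, i, hk, hki⟩ := (key d hd.pos).1 h
    obtain ⟨j, rfl⟩ := exists_eq_two_pow_add_one hF hm hd hdm hk hki
    -- The new exponent `j` may differ from `k`; its coprimality to `m` comes again from maximum
    -- nonlinearity.
    exact ⟨hm, j, h.1.gcd_eq_one (i := 0) hF fun x => by simp, rfl⟩
  · rintro ⟨hm, k, hk, rfl⟩
    exact (key _ hd.pos).2 ⟨hm, k, 0, hk, fun x => by simp⟩
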